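/- Let $V$ be a Hermitian space, i.e. a complex inner product space (not necessarily complete), with inner product $p^*q$ antilinear in $p$ and linear in $q$. The Klauder space is $Kl(V)=\mathbb{C}\times V$ with elements $z=[z_0,\mathbf z]$ and coherent product $$K(z,z')=e^{\overline{z_0}+z_0'+\mathbf z^*\mathbf z'} .$$ Let $\mathbb Q$ be a quantum space of $Kl(V)$, i.e. a Hermitian space algebraically spanned by vectors $|z\rangle$ ($z\in Kl(V)$) with $\langle z|z'\rangle=K(z,z')$; let $\mathbb Q^\times$ be the space of all antilinear functionals on $\mathbb Q$, and $\overline{\mathbb Q}\subseteq\mathbb Q^\times$ the Hilbert space completion of $\mathbb Q$, where $\psi\in\overline{\mathbb Q}$ is identified with the functional $\phi\mapsto\phi^*\psi$. For $\rho\in\mathbb C$ and $p,q\in V$, the map $[\rho,p,q,1]:[z_0,\mathbf z]\mapsto[\rho+z_0+p^*\mathbf z,\;q+\mathbf z]$ of $Kl(V)$ is coherent with adjoint $[\overline\rho,q,p,1]$, that is, $K(z,Az')=K(A^*z,z')$ for $A=[\rho,p,q,1]$ and $A^*=[\overline\rho,q,p,1]$. For such $A$ let $\Gamma(A)$ be the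 linear operator on $\mathbb Q$ with $\Gamma(A)|z\rangle=|Az\rangle$, extended to $\mathbb Q^\times$ by $(\Gamma(A)\psi)(\phi)=\psi(\Gamma(A^*)\phi)$. The annihilation and creation operators are the linear operators in $\mathbb Q^\times$ $$p^*\mathbf a=\lim_{\varepsilon\to0}\frac{\Gamma([0,\varepsilon p,0,1])-1}{\varepsilon},\qquad \mathbf a^*q=\lim_{\varepsilon\to0}\frac{\Gamma([0,0,\varepsilon q,1])-1}{\varepsilon}\qquad(\varepsilon\in\mathbb R),$$ each defined on all $\psi\in\mathbb Q^\times$ for which the limit exists pointwise on $\mathbb Q$. Let $\Phi_s(q)=\frac1{\sqrt2}\,(q^*\mathbf a+\mathbf a^*q)$ be the Segal field operators. Sums, products and commutators $[S,T]=ST-TS$ of such operators have their natural domains. **Theorem.** For all $p,q\in V$, the completed quantum space $\overline{\mathbb Q}$ is contained in the domains of the commutators below, and on $\overline{\mathbb Q}$ the creation and annihilation operators satisfy the commutation relations $$[p^*\mathbf a,\mathbf a^*q]=p^*q,\qquad [p^*\mathbf a,q^*\mathbf a]=[\mathbf a^*p,\mathbf a^*q]=0 .$$ In particular, the Segal field operators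 satisfy on $\overline{\mathbb Q}$ the canonical commutation relations $$[\Phi_s(p),\Phi_s(q)]=i\,\operatorname{Im}(p^*q).$$ -/

import Mathlib

open Filter Topology ComplexConjugate
open scoped InnerProductSpace

noncomputable section

namespace CoherentFock

universe u v w

/-! ### Quantum spaces of a coherent product -/

/-- `Q` is a quantum space of the set `Z` with coherent product `K`: a Hermitian space that is
algebraically spanned by coherent states `ket z` (`z ∈ Z`) with `⟨z|z'⟩ = K(z,z')`. -/
structure QuantumSpace {Z : Type u} (K : Z → Z → ℂ) (Q : Type v)
    [NormedAddCommGroup Q] [InnerProductSpace ℂ Q] where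
  ket : Z → Q
  inner_ket : ∀ z z' : Z, ⟪ket z, ket z'⟫_ℂ = K z z'
  span_ket : Submodule.span ℂ (Set.range ket) = ⊤

/-- A coherent map `A` on `Z`, together with an adjoint map `A*`:
`K(z, A z') = K(A* z, z')`. -/
structure CoherentMap {Z : Type u} (K : Z → Z → ℂ) where
  toFun : Z → Z
  adj : Z → Z
  adjoint_eq : ∀ z z' : Z, K z (toFun z') = K (adj z) z'

/-- The augmented quantum space `Q^×`, the antidual of `Q`: all antilinear functionals on `Q`. -/
abbrev Antidual (Q : Type v) [NormedAddCommGroup Q] [InnerProductSpace ℂ Q] : Type v :=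
  Q →ₛₗ[starRingEnd ℂ] ℂ

/-- The embedding of the Hilbert space completion of `Q` into the antidual of `Q`, where `ψ` is
identified with the functional `φ ↦ φ^* ψ`. -/
def completionToAntidual (Q : Type v) [NormedAddCommGroup Q] [InnerProductSpace ℂ Q] :
    UniformSpace.Completion Q →ₗ[ℂ] Antidual Q where
  toFun ψ :=
    { toFun := fun φ => ⟪(φ : UniformSpace.Completion Q), ψ⟫_ℂ
      map_add' := fun φ φ' => by
        rw [UniformSpace.Completion.coe_add, inner_add_left]
      map_smul' := fun c φ => by
        rw [UniformSpace.Completion.coe_smul, inner_smul_left, smul_eq_mul] }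
  map_add' ψ ψ' := LinearMap.ext fun φ =>
    inner_add_right (𝕜 := ℂ) (φ : UniformSpace.Completion Q) ψ ψ'
  map_smul' c ψ := LinearMap.ext fun φ =>
    inner_smul_right (𝕜 := ℂ) (φ : UniformSpace.Completion Q) ψ c

/-- The completed quantum space, as a subspace of the augmented quantum space. -/
def completedQuantumSpace (Q : Type v) [NormedAddCommGroup Q] [InnerProductSpace ℂ Q] :
    Submodule ℂ (Antidual Q) :=
  LinearMap.range (completionToAntidual Q)

section Quantization

variable {Z : Type u} {K : Z → Z → ℂ} {Q : Type v} [NormedAddCommGroup Q] [InnerProductSpace ℂ Q]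

/-- The adjoint of a coherent map is coherent. This uses that `K` is Hermitian, which holds for
every kernel that has a quantum space. -/
def CoherentMap.adjoint (𝒬 : QuantumSpace K Q) (A : CoherentMap K) : CoherentMap K where
  toFun := A.adj
  adj := A.toFun
  adjoint_eq z z' := by
    have h := A.adjoint_eq z' z
    rw [← 𝒬.inner_ket, ← 𝒬.inner_ket] at h ⊢
    rw [← inner_conj_symm (𝒬.ket z), ← h, inner_conj_symm]

/-- Every vector of a quantum space is a finite linear combination of coherent states. -/
theorem QuantumSpace.linearCombination_surjective (𝒬 : QuantumSpace K Q) :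
    Function.Surjective (Finsupp.linearCombination ℂ 𝒬.ket) := by
  rw [← LinearMap.range_eq_top, Finsupp.range_linearCombination, 𝒬.span_ket]

/-- A vector orthogonal to all coherent states is zero. -/
theorem QuantumSpace.eq_zero_of_inner_ket (𝒬 : QuantumSpace K Q) {φ : Q}
    (h : ∀ z, ⟪𝒬.ket z, φ⟫_ℂ = 0) : φ = 0 := by
  have h1 : φ ∈ (Submodule.span ℂ (Set.range 𝒬.ket))ᗮ := by
    rw [Submodule.mem_orthogonal]
    intro x hx
    induction hx using Submodule.span_induction with
    | mem x hx => obtain ⟨z, rfl⟩ := hx; exact h z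
    | zero => exact inner_zero_left _
    | add x y _ _ hx hy => rw [inner_add_left, hx, hy, add_zero]
    | smul c x _ hx => rw [inner_smul_left, hx, mul_zero]
  rwa [𝒬.span_ket, Submodule.top_orthogonal_eq_bot, Submodule.mem_bot] at h1

theorem QuantumSpace.inner_linearCombination (𝒬 : QuantumSpace K Q) (A : CoherentMap K) (z : Z)
    (c : Z →₀ ℂ) :
    ⟪𝒬.ket z, Finsupp.linearCombination ℂ (fun z' => 𝒬.ket (A.toFun z')) c⟫_ℂ =
      ⟪𝒬.ket (A.adj z), Finsupp.linearCombination ℂ 𝒬.ket c⟫_ℂ := by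
  simp only [Finsupp.linearCombination_apply, Finsupp.sum, inner_sum, inner_smul_right,
    𝒬.inner_ket, A.adjoint_eq]

theorem QuantumSpace.ker_le (𝒬 : QuantumSpace K Q) (A : CoherentMap K) :
    LinearMap.ker (Finsupp.linearCombination ℂ 𝒬.ket) ≤
      LinearMap.ker (Finsupp.linearCombination ℂ (fun z' => 𝒬.ket (A.toFun z'))) := by
  intro c hc
  rw [LinearMap.mem_ker] at hc ⊢
  refine 𝒬.eq_zero_of_inner_ket fun z => ?_
  rw [𝒬.inner_linearCombination A z c, hc, inner_zero_right]

/-- The quantization `Γ(A) : Q → Q` of a coherent map: the linear map with `Γ(A)|z⟩ = |A z⟩`. -/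
def QuantumSpace.quantize (𝒬 : QuantumSpace K Q) (A : CoherentMap K) : Q →ₗ[ℂ] Q :=
  ((LinearMap.ker (Finsupp.linearCombination ℂ 𝒬.ket)).liftQ
      (Finsupp.linearCombination ℂ (fun z' => 𝒬.ket (A.toFun z'))) (𝒬.ker_le A)).comp
    ((Finsupp.linearCombination ℂ 𝒬.ket).quotKerEquivOfSurjective
      𝒬.linearCombination_surjective).symm.toLinearMap

theorem QuantumSpace.quantize_ket (𝒬 : QuantumSpace K Q) (A : CoherentMap K) (z : Z) :
    𝒬.quantize A (𝒬.ket z) = 𝒬.ket (A.toFun z) := by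
  have h : ((Finsupp.linearCombination ℂ 𝒬.ket).quotKerEquivOfSurjective
      𝒬.linearCombination_surjective).symm (𝒬.ket z) =
      Submodule.Quotient.mk (Finsupp.single z (1 : ℂ)) := by
    rw [LinearEquiv.symm_apply_eq]
    simp [LinearMap.quotKerEquivOfSurjective]
  simp [QuantumSpace.quantize, h]

/-- The extension `Γ(A) := Γ(A*)^*` of the quantization map to the augmented quantum space. -/
def QuantumSpace.quantizeExt (𝒬 : QuantumSpace K Q) (A : CoherentMap K) :
    Antidual Q →ₗ[ℂ] Antidual Q where
  toFun ψ := ψ.comp (𝒬.quantize (A.adjoint 𝒬))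
  map_add' _ _ := rfl
  map_smul' _ _ := rfl

/-- The graph of the operator `ψ ↦ lim_{ε → 0} (Γ(A_ε) ψ - ψ) / ε` on the augmented quantum
space, for a family `A_ε` of coherent maps depending on a real parameter `ε`. The limit is the
pointwise one. -/
def QuantumSpace.generatorGraph (𝒬 : QuantumSpace K Q) (A : ℝ → CoherentMap K) :
    Submodule ℂ (Antidual Q × Antidual Q) where
  carrier := {x | ∀ φ : Q, Tendsto
    (fun ε : ℝ => ((𝒬.quantizeExt (A ε) x.1 - x.1) φ) / (ε : ℂ)) (𝓝[≠] 0) (𝓝 (x.2 φ))}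
  zero_mem' φ := by simp
  add_mem' {x y} hx hy φ := by
    refine ((hx φ).add (hy φ)).congr fun ε => ?_
    simp only [Prod.fst_add, map_add, LinearMap.sub_apply, LinearMap.add_apply]
    ring
  smul_mem' c x hx φ := by
    refine ((hx φ).const_mul c).congr fun ε => ?_
    simp only [Prod.smul_fst, map_smul, LinearMap.sub_apply, LinearMap.smul_apply, smul_eq_mul]
    ring

/-- The graph above is that of a single-valued operator. -/
theorem QuantumSpace.generatorGraph_fst_eq_zero (𝒬 : QuantumSpace K Q) (A : ℝ → CoherentMap K)
    (x : Antidual Q × Antidual Q) (hx : x ∈ 𝒬.generatorGraph A) (h0 : x.1 = 0) : x.2 = 0 := by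
  ext φ
  have h := hx φ
  simp only [h0, map_zero, sub_zero, LinearMap.zero_apply, zero_div] at h
  exact tendsto_nhds_unique h tendsto_const_nhds

/-- The operator `lim_{ε → 0} (Γ(A_ε) - 1) / ε` on the augmented quantum space, with domain the
set of all `ψ` for which the limit exists. -/
def QuantumSpace.generator (𝒬 : QuantumSpace K Q) (A : ℝ → CoherentMap K) :
    Antidual Q →ₗ.[ℂ] Antidual Q :=
  (𝒬.generatorGraph A).toLinearPMap

theorem QuantumSpace.generator_graph (𝒬 : QuantumSpace K Q) (A : ℝ → CoherentMap K) :
    (𝒬.generator A).graph = 𝒬.generatorGraph A :=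
  Submodule.toLinearPMap_graph_eq _ (𝒬.generatorGraph_fst_eq_zero A)

end Quantization

/-! ### Products and commutators of partially defined operators -/

section Partial

variable {E : Type u} [AddCommGroup E] [Module ℂ E]

/-- The product `S T` of two partially defined operators, with its natural domain
`{ψ ∈ dom T | T ψ ∈ dom S}`. -/
def pmul (S T : E →ₗ.[ℂ] E) : E →ₗ.[ℂ] E where
  domain := (S.domain.comap T.toFun).map T.domain.subtype
  toFun :=
    { toFun := fun x => S ⟨T ⟨x, by
          obtain ⟨y, _, hy⟩ := x.2
          exact hy ▸ y.2⟩, by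
          obtain ⟨y, hy, hyx⟩ := x.2
          have : y = ⟨x, by exact hyx ▸ y.2⟩ := Subtype.ext hyx
          rw [← this]
          exact hy⟩
      map_add' := fun x y => by
        rw [← S.map_add]
        congr 1
        apply Subtype.ext
        change T _ = T _ + T _
        rw [← T.map_add]
        rfl
      map_smul' := fun c x => by
        rw [RingHom.id_apply, ← S.map_smul]
        congr 1
        apply Subtype.ext
        change T _ = c • T _
        rw [← T.map_smul]
        rfl }

/-- The commutator `[S, T] = S T - T S`, with its natural domain. -/
def pcomm (S T : E →ₗ.[ℂ] E) : E →ₗ.[ℂ] E := pmul S T - pmul T S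

theorem mem_graph_pmul (S T : E →ₗ.[ℂ] E) (x z : E) :
    (x, z) ∈ (pmul S T).graph ↔ ∃ y, (x, y) ∈ T.graph ∧ (y, z) ∈ S.graph := by
  simp only [LinearPMap.mem_graph_iff]
  constructor
  · rintro ⟨⟨a, b, hb, hba⟩, hax, haz⟩
    refine ⟨T b, ⟨b, hba.trans hax, rfl⟩, ⟨T b, hb⟩, rfl, ?_⟩
    subst hba
    exact haz
  · rintro ⟨y, ⟨a, rfl, rfl⟩, b, hb, rfl⟩
    refine ⟨⟨a, a, ?_, rfl⟩, rfl, ?_⟩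
    · change T a ∈ S.domain
      rw [← hb]
      exact b.2
    · exact congrArg S (Subtype.ext hb.symm : (⟨T a, hb ▸ b.2⟩ : S.domain) = b)

end Partial

/-! ### Klauder spaces and the operators of the bosonic Fock space -/

section Klauder

variable (V : Type u) [NormedAddCommGroup V] [InnerProductSpace ℂ V]

/-- The coherent product `K(z,z') = exp(conj z₀ + z₀' + 𝐳^* 𝐳')` of the Klauder space
`Kl(V) = ℂ × V` over the Hermitian space `V`. -/
def klauderProduct (z z' : ℂ × V) : ℂ :=
  Complex.exp (conj z.1 + z'.1 + ⟪z.2, z'.2⟫_ℂ)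

variable {V}

/-- The element `[ρ, p, q, 1]` of the oscillator semigroup, acting on `Kl(V)` by
`[z₀, 𝐳] ↦ [ρ + z₀ + p^* 𝐳, q + 𝐳]`, with adjoint `[conj ρ, q, p, 1]`. -/
def oscillator (ρ : ℂ) (p q : V) : CoherentMap (klauderProduct V) where
  toFun z := (ρ + z.1 + ⟪p, z.2⟫_ℂ, q + z.2)
  adj z := (conj ρ + z.1 + ⟪q, z.2⟫_ℂ, p + z.2)
  adjoint_eq z z' := by
    simp only [klauderProduct, map_add, Complex.conj_conj, inner_conj_symm, inner_add_left,
      inner_add_right]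
    congr 1
    ring

variable {Q : Type v} [NormedAddCommGroup Q] [InnerProductSpace ℂ Q]

/-- `dΓ(X) = lim_{ε → 0} (Γ([ε ρ, ε p, ε q, 1]) - 1) / ε` for the element `X = X_{ρ,p,q,0}` of the
oscillator algebra. -/
def dGamma (𝒬 : QuantumSpace (klauderProduct V) Q) (ρ : ℂ) (p q : V) :
    Antidual Q →ₗ.[ℂ] Antidual Q :=
  𝒬.generator fun ε : ℝ => oscillator ((ε : ℂ) * ρ) ((ε : ℂ) • p) ((ε : ℂ) • q)

/-- The annihilation operator `q^* a = dΓ(X_{0,q,0,0})`. -/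
def annihilation (𝒬 : QuantumSpace (klauderProduct V) Q) (q : V) :
    Antidual Q →ₗ.[ℂ] Antidual Q :=
  dGamma 𝒬 0 q 0

/-- The creation operator `a^* q = dΓ(X_{0,0,q,0})`. -/
def creation (𝒬 : QuantumSpace (klauderProduct V) Q) (q : V) :
    Antidual Q →ₗ.[ℂ] Antidual Q :=
  dGamma 𝒬 0 0 q

/-- The Segal field operator `Φ_s(q) = (q^* a + a^* q) / √2`. -/
def segal (𝒬 : QuantumSpace (klauderProduct V) Q) (q : V) :
    Antidual Q →ₗ.[ℂ] Antidual Q :=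
  ((Real.sqrt 2 : ℂ)⁻¹) • (annihilation 𝒬 q + creation 𝒬 q)

end Klauder

/-! ### Every Klauder space has a quantum space -/

section Existence

open scoped ComplexOrder Matrix

/-- The kernel of inner products of a family of vectors is positive semidefinite. -/
theorem posSemidef_inner {ι : Type u} {E : Type v} [NormedAddCommGroup E]
    [InnerProductSpace ℂ E] (x : ι → E) :
    (Matrix.of fun i j : ι => ⟪x i, x j⟫_ℂ).PosSemidef := by
  refine ⟨?_, fun c => ?_⟩
  · ext i j
    simp [Matrix.conjTranspose_apply]
  · have h : (c.sum fun i a => c.sum fun j b => star a * ⟪x i, x j⟫_ℂ * b) =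
        ⟪c.sum fun i a => a • x i, c.sum fun i a => a • x i⟫_ℂ := by
      simp only [Finsupp.sum]
      rw [sum_inner]
      refine Finset.sum_congr rfl fun i _ => ?_
      rw [inner_sum]
      refine Finset.sum_congr rfl fun j _ => ?_
      rw [inner_smul_left, inner_smul_right, RCLike.star_def]
      ring
    simp only [Matrix.of_apply]
    rw [h, inner_self_eq_norm_sq_to_K]
    have h2 : (0 : ℝ) ≤ ‖c.sum fun i a => a • x i‖ ^ 2 := sq_nonneg _
    have h3 := Complex.zero_le_real.2 h2
    rw [Complex.ofReal_pow] at h3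
    exact h3

variable (V : Type u) [NormedAddCommGroup V] [InnerProductSpace ℂ V]

theorem posSemidef_expansion (n : ℕ) :
    (Matrix.of fun z z' : ℂ × V =>
      conj (Complex.exp z.1) * Complex.exp z'.1 * ⟪z.2, z'.2⟫_ℂ ^ n).PosSemidef := by
  induction n with
  | zero =>
    have h := posSemidef_inner (fun z : ℂ × V => Complex.exp z.1)
    convert! h using 1
    ext z z'
    simp [mul_comm]
  | succ n ih =>
    have h := ih.hadamard (posSemidef_inner (fun z : ℂ × V => z.2))
    convert! h using 1
    ext z z'
    simp only [Matrix.of_apply, Matrix.hadamard_apply]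
    ring

theorem klauderProduct_nonneg (c : ℂ × V →₀ ℂ) :
    0 ≤ (c.sum fun z a => c.sum fun z' b => conj a * klauderProduct V z z' * b).re := by
  have key : HasSum (fun n : ℕ => ((n.factorial : ℝ)⁻¹ *
      (c.sum fun z a => c.sum fun z' b => conj a *
        (conj (Complex.exp z.1) * Complex.exp z'.1 * ⟪z.2, z'.2⟫_ℂ ^ n) * b).re))
      (c.sum fun z a => c.sum fun z' b => conj a * klauderProduct V z z' * b).re := by
    have h : HasSum (fun n : ℕ => c.sum fun z a => c.sum fun z' b =>
        conj a * (conj (Complex.exp z.1) * Complex.exp z'.1 * (((n.factorial : ℂ))⁻¹ *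
          ⟪z.2, z'.2⟫_ℂ ^ n)) * b)
        (c.sum fun z a => c.sum fun z' b => conj a * klauderProduct V z z' * b) := by
      refine hasSum_sum fun z _ => hasSum_sum fun z' _ => ?_
      have h1 := NormedSpace.exp_series_hasSum_exp' (𝕂 := ℂ) ⟪z.2, z'.2⟫_ℂ
      rw [← Complex.exp_eq_exp_ℂ] at h1
      have h2 := ((h1.mul_left (conj (Complex.exp z.1) * Complex.exp z'.1)).mul_left
        (conj (c z))).mul_right (c z')
      simpa only [klauderProduct, Complex.exp_add, ← Complex.exp_conj, smul_eq_mul] using h2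
    refine (Complex.hasSum_re h).congr_fun ?_
    intro n
    rw [← Complex.re_ofReal_mul]
    congr 1
    simp only [Finsupp.sum, Finset.mul_sum]
    refine Finset.sum_congr rfl fun z _ => Finset.sum_congr rfl fun z' _ => ?_
    push_cast
    ring
  refine key.nonneg fun n => mul_nonneg (by positivity) ?_
  exact (Complex.le_def.1 ((posSemidef_expansion V n).2 c)).1

/-- Every Klauder space has a quantum space: the span of the kernel functions in the reproducing
kernel Hilbert space of its coherent product. -/
theorem exists_quantumSpace : ∃ (Q : Type u) (_ : NormedAddCommGroup Q)
    (_ : InnerProductSpace ℂ Q), Nonempty (QuantumSpace (klauderProduct V) Q) := by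
  let M : Matrix (ℂ × V) (ℂ × V) (ℂ →L[ℂ] ℂ) :=
    Matrix.of fun z z' => klauderProduct V z z' • ContinuousLinearMap.id ℂ ℂ
  have hconj : ∀ z z' : ℂ × V, conj (klauderProduct V z z') = klauderProduct V z' z := by
    intro z z'
    simp only [klauderProduct, ← Complex.exp_conj, map_add, Complex.conj_conj, inner_conj_symm]
    ring_nf
  have hM : M.PosSemidef := by
    have h0 : M.IsHermitian ∧ ∀ (vv : ℂ × V →₀ ℂ),
        0 ≤ RCLike.re (vv.sum fun x w ↦ vv.sum fun x' w' ↦ ⟪M x' x w, w'⟫_ℂ) := by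
      refine ⟨?_, fun c => ?_⟩
      · ext z z'
        have h1 : star (ContinuousLinearMap.id ℂ ℂ) = ContinuousLinearMap.id ℂ ℂ := star_one _
        simp [M, Matrix.conjTranspose_apply, hconj, h1]
      · have h := klauderProduct_nonneg V c
        convert! h using 1
        simp only [M, Matrix.of_apply, RCLike.inner_apply]
        simp only [FunLike.coe_smul, Pi.smul_apply, ContinuousLinearMap.coe_id', id_eq,
          smul_eq_mul, map_mul, hconj, RCLike.re_eq_complex_re, Finsupp.sum]
        congr 1
        refine Finset.sum_congr rfl fun z _ => Finset.sum_congr rfl fun z' _ => ?_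
        ring
    exact (RKHS.posSemidef_tfae.out 0 2).mpr h0
  have : Fact M.PosSemidef := ⟨hM⟩
  let H := RKHS.OfKernel M
  let k : ℂ × V → H := fun z => RKHS.kerFun H z 1
  have hk : ∀ z z', ⟪k z, k z'⟫_ℂ = klauderProduct V z z' := by
    intro z z'
    change ⟪RKHS.kerFun H z (1 : ℂ), RKHS.kerFun H z' (1 : ℂ)⟫_ℂ = _
    rw [← RKHS.kernel_inner, RKHS.OfKernel.kernel_ofKernel]
    simp [M, hconj]
  let S : Submodule ℂ H := Submodule.span ℂ (Set.range k)
  let kS : ℂ × V → S := fun z => ⟨k z, Submodule.subset_span ⟨z, rfl⟩⟩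
  refine ⟨S, inferInstance, inferInstance, ⟨⟨kS, hk, ?_⟩⟩⟩
  apply Submodule.map_injective_of_injective S.injective_subtype
  rw [Submodule.map_span, ← Set.range_comp, Submodule.map_top, Submodule.range_subtype]
  rfl

end Existence

end CoherentFock

end

/-! A functional `ψ` in the antidual is determined by the function `f z = ψ (𝒬.ket z)` on `ℂ × V`,
and `Γ(A)` acts on it by `f ↦ f ∘ A.adj`. For annihilation, `A.adj` is the translation by `ε • p` in
the second component, so `p^* a` is the directional derivative of `f` along `(0, p)`. For creation,
`A.adj` shifts only `z₀`, which rescales the coherent state by an exponential, so `a^* q` is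
multiplication by `⟪z.2, q⟫`. Multiplications commute, directional derivatives commute if `f` is
regular enough, and the product rule leaves exactly the term `⟪p, q⟫ • f` in the mixed commutator.
The Segal relations follow by bilinearity.

The analytic content is that every `ψ` in the completed space lies in the domains of all these
products. On `Q` itself, `f` is a finite combination of the functions `klauderProduct V · w`, which
are antiholomorphic along complex lines and are joint eigenfunctions of all directional derivatives.
Coherent states are bounded in norm on balls (`norm_ket_le`), so a norm limit of vectors of `Q`
gives a limit of functions uniform on balls. By Weierstrass' theorem and Cauchy's estimate on
complex lines, such limits preserve antiholomorphy, first derivatives, and the symmetry of second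
derivatives (`TendstoUniformlyOnBalls.conjLineHolomorphicTwo`). -/

namespace CoherentFock

universe u v

/-! ### Derivatives along antiholomorphic complex lines -/

section ConjLine

variable {E : Type u} [NormedAddCommGroup E]

/-- Uniform convergence on all balls around the origin. -/
def TendstoUniformlyOnBalls (f : ℕ → E → ℂ) (g : E → ℂ) : Prop :=
  ∀ R : ℝ, TendstoUniformlyOn f g atTop (Metric.closedBall 0 R)

theorem TendstoUniformlyOnBalls.tendsto {f : ℕ → E → ℂ} {g : E → ℂ}
    (h : TendstoUniformlyOnBalls f g) (z : E) : Tendsto (fun n => f n z) atTop (𝓝 (g z)) :=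
  (h ‖z‖).tendsto_at (by simp)

variable [NormedSpace ℂ E]

/-- `f` is antiholomorphic on every complex line. -/
def ConjLineHolomorphic (f : E → ℂ) : Prop :=
  ∀ z p : E, Differentiable ℂ fun s : ℂ => f (z + conj s • p)

/-- The derivative of `f` in the direction `p`, along the antiholomorphic line through `z`. -/
noncomputable def conjLineDeriv (p : E) (f : E → ℂ) (z : E) : ℂ :=
  deriv (fun s : ℂ => f (z + conj s • p)) 0

theorem ConjLineHolomorphic.hasDerivAt {f : E → ℂ} (hf : ConjLineHolomorphic f) (z p : E) :
    HasDerivAt (fun s : ℂ => f (z + conj s • p)) (conjLineDeriv p f z) 0 :=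
  (hf z p 0).hasDerivAt

theorem conjLineDeriv_eq {f : E → ℂ} {z p : E} {d : ℂ}
    (h : HasDerivAt (fun s : ℂ => f (z + conj s • p)) d 0) : conjLineDeriv p f z = d :=
  h.deriv

theorem ConjLineHolomorphic.add {f g : E → ℂ} (hf : ConjLineHolomorphic f)
    (hg : ConjLineHolomorphic g) : ConjLineHolomorphic (f + g) :=
  fun z p => (hf z p).add (hg z p)

theorem ConjLineHolomorphic.const_smul {f : E → ℂ} (hf : ConjLineHolomorphic f) (c : ℂ) :
    ConjLineHolomorphic (c • f) :=
  fun z p => (hf z p).const_smul c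

theorem ConjLineHolomorphic.sub {f g : E → ℂ} (hf : ConjLineHolomorphic f)
    (hg : ConjLineHolomorphic g) : ConjLineHolomorphic (f - g) :=
  fun z p => (hf z p).sub (hg z p)

theorem conjLineHolomorphic_zero : ConjLineHolomorphic (0 : E → ℂ) :=
  fun _ _ => differentiable_const _

theorem conjLineDeriv_zero (p : E) : conjLineDeriv p (0 : E → ℂ) = 0 :=
  funext fun _ => conjLineDeriv_eq (hasDerivAt_const _ _)

theorem conjLineDeriv_add {f g : E → ℂ} (hf : ConjLineHolomorphic f)
    (hg : ConjLineHolomorphic g) (p : E) :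
    conjLineDeriv p (f + g) = conjLineDeriv p f + conjLineDeriv p g :=
  funext fun z => conjLineDeriv_eq ((hf.hasDerivAt z p).add (hg.hasDerivAt z p))

theorem conjLineDeriv_sub {f g : E → ℂ} (hf : ConjLineHolomorphic f)
    (hg : ConjLineHolomorphic g) (p : E) :
    conjLineDeriv p (f - g) = conjLineDeriv p f - conjLineDeriv p g :=
  funext fun z => conjLineDeriv_eq ((hf.hasDerivAt z p).sub (hg.hasDerivAt z p))

theorem conjLineDeriv_const_smul {f : E → ℂ} (hf : ConjLineHolomorphic f) (c : ℂ) (p : E) :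
    conjLineDeriv p (c • f) = c • conjLineDeriv p f :=
  funext fun z => conjLineDeriv_eq ((hf.hasDerivAt z p).const_smul c)

/-- Weierstrass' theorem on each line: a compact set of parameters is mapped into a ball, where
convergence is uniform. -/
theorem TendstoUniformlyOnBalls.conjLineHolomorphic {f : ℕ → E → ℂ} {g : E → ℂ}
    (h : TendstoUniformlyOnBalls f g) (hf : ∀ n, ConjLineHolomorphic (f n)) :
    ConjLineHolomorphic g := by
  intro z p
  rw [← differentiableOn_univ]
  refine TendstoLocallyUniformlyOn.differentiableOn (F := fun n (s : ℂ) => f n (z + conj s • p))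
    (φ := atTop) ?_ (Eventually.of_forall fun n => (hf n z p).differentiableOn) isOpen_univ
  rw [tendstoLocallyUniformlyOn_iff_forall_isCompact isOpen_univ]
  intro S _ hS
  obtain ⟨R, hR⟩ := hS.isBounded.exists_norm_le
  refine ((h (‖z‖ + R * ‖p‖)).comp (fun s : ℂ => z + conj s • p)).mono fun s hs => ?_
  simp only [Set.mem_preimage, mem_closedBall_zero_iff]
  refine (norm_add_le _ _).trans ?_
  rw [norm_smul, RCLike.norm_conj]
  gcongr
  exact hR s hs

/-- Cauchy's estimate turns uniform convergence on balls into that of the derivatives. -/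
theorem TendstoUniformlyOnBalls.conjLineDeriv {f : ℕ → E → ℂ} {g : E → ℂ}
    (h : TendstoUniformlyOnBalls f g) (hf : ∀ n, ConjLineHolomorphic (f n)) (p : E) :
    TendstoUniformlyOnBalls (fun n => conjLineDeriv p (f n)) (conjLineDeriv p g) := by
  intro R
  have hg := h.conjLineHolomorphic hf
  rw [Metric.tendstoUniformlyOn_iff]
  intro ε hε
  filter_upwards [Metric.tendstoUniformlyOn_iff.1 (h (R + ‖p‖)) (ε / 2) (half_pos hε)]
    with n hn z hz
  rw [dist_eq_norm, ← Pi.sub_apply, ← conjLineDeriv_sub hg (hf n)]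
  refine lt_of_le_of_lt ?_ (half_lt_self hε)
  -- On the unit circle of parameters the line through `z` stays in the ball of radius `R + ‖p‖`,
  -- which is why uniform closeness was taken there. Since balls of every radius are allowed, the
  -- notion of convergence is stable under differentiation and the estimate can be iterated.
  have key := Complex.norm_deriv_le_of_forall_mem_sphere_norm_le (c := 0) (R := 1) (C := ε / 2)
    (f := fun s : ℂ => (g - f n) (z + conj s • p)) one_pos ((hg.sub (hf n)) z p).diffContOnCl
    fun s hs => ?_
  · rwa [div_one] at key
  · rw [Pi.sub_apply, ← dist_eq_norm]
    refine (hn _ ?_).le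
    rw [mem_closedBall_zero_iff] at hz ⊢
    rw [mem_sphere_zero_iff_norm] at hs
    refine (norm_add_le _ _).trans ?_
    rw [norm_smul, RCLike.norm_conj, hs, one_mul]
    gcongr

/-- `f` is antiholomorphic on complex lines together with its directional derivatives, and these
commute. -/
structure ConjLineHolomorphicTwo (f : E → ℂ) : Prop where
  holomorphic : ConjLineHolomorphic f
  deriv_holomorphic : ∀ p, ConjLineHolomorphic (conjLineDeriv p f)
  deriv_comm : ∀ p q, conjLineDeriv p (conjLineDeriv q f) = conjLineDeriv q (conjLineDeriv p f)

theorem ConjLineHolomorphicTwo.zero : ConjLineHolomorphicTwo (0 : E → ℂ) where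
  holomorphic := conjLineHolomorphic_zero
  deriv_holomorphic p := by rw [conjLineDeriv_zero]; exact conjLineHolomorphic_zero
  deriv_comm p q := by simp only [conjLineDeriv_zero]

theorem ConjLineHolomorphicTwo.add {f g : E → ℂ} (hf : ConjLineHolomorphicTwo f)
    (hg : ConjLineHolomorphicTwo g) : ConjLineHolomorphicTwo (f + g) where
  holomorphic := hf.1.add hg.1
  deriv_holomorphic p := by
    rw [conjLineDeriv_add hf.1 hg.1]
    exact (hf.2 p).add (hg.2 p)
  deriv_comm p q := by
    rw [conjLineDeriv_add hf.1 hg.1, conjLineDeriv_add hf.1 hg.1,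
      conjLineDeriv_add (hf.2 q) (hg.2 q), conjLineDeriv_add (hf.2 p) (hg.2 p), hf.3, hg.3]

theorem ConjLineHolomorphicTwo.const_smul {f : E → ℂ} (hf : ConjLineHolomorphicTwo f) (c : ℂ) :
    ConjLineHolomorphicTwo (c • f) where
  holomorphic := hf.1.const_smul c
  deriv_holomorphic p := by
    rw [conjLineDeriv_const_smul hf.1]
    exact (hf.2 p).const_smul c
  deriv_comm p q := by
    rw [conjLineDeriv_const_smul hf.1, conjLineDeriv_const_smul hf.1,
      conjLineDeriv_const_smul (hf.2 q), conjLineDeriv_const_smul (hf.2 p), hf.3]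

/-- Differentiating the convergence twice, in either order, gives the same approximating sequence;
uniqueness of limits then makes the second derivatives of `g` symmetric, without any Fréchet
differentiability. -/
theorem TendstoUniformlyOnBalls.conjLineHolomorphicTwo {f : ℕ → E → ℂ} {g : E → ℂ}
    (h : TendstoUniformlyOnBalls f g) (hf : ∀ n, ConjLineHolomorphicTwo (f n)) :
    ConjLineHolomorphicTwo g where
  holomorphic := h.conjLineHolomorphic fun n => (hf n).1
  deriv_holomorphic p :=
    (h.conjLineDeriv (fun n => (hf n).1) p).conjLineHolomorphic fun n => (hf n).2 p
  deriv_comm p q := by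
    have h2 := fun p q => (h.conjLineDeriv (fun n => (hf n).1) q).conjLineDeriv
      (fun n => (hf n).2 q) p
    funext z
    refine tendsto_nhds_unique ((h2 p q).tendsto z) ?_
    simp only [fun n => (hf n).3 p q]
    exact (h2 q p).tendsto z

end ConjLine

/-! ### Generators as pointwise limits on coherent states -/

section Generator

variable {Z : Type u} {K : Z → Z → ℂ} {Q : Type v} [NormedAddCommGroup Q] [InnerProductSpace ℂ Q]

theorem QuantumSpace.ket_induction (𝒬 : QuantumSpace K Q) {P : Q → Prop}
    (ket : ∀ z, P (𝒬.ket z)) (zero : P 0) (add : ∀ x y, P x → P y → P (x + y))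
    (smul : ∀ (c : ℂ) x, P x → P (c • x)) (φ : Q) : P φ := by
  have hφ : φ ∈ Submodule.span ℂ (Set.range 𝒬.ket) := 𝒬.span_ket ▸ Submodule.mem_top
  induction hφ using Submodule.span_induction with
  | mem x hx => obtain ⟨z, rfl⟩ := hx; exact ket z
  | zero => exact zero
  | add x y _ _ hx hy => exact add x y hx hy
  | smul c x _ hx => exact smul c x hx

theorem QuantumSpace.antidual_ext (𝒬 : QuantumSpace K Q) {ψ χ : Antidual Q}
    (h : ∀ z, ψ (𝒬.ket z) = χ (𝒬.ket z)) : ψ = χ := by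
  ext φ
  refine 𝒬.ket_induction (P := fun φ => ψ φ = χ φ) h (by simp) (fun x y hx hy => ?_)
    (fun c x hx => ?_) φ
  · rw [map_add, map_add, hx, hy]
  · rw [map_smulₛₗ, map_smulₛₗ, hx]

theorem QuantumSpace.quantizeExt_ket (𝒬 : QuantumSpace K Q) (A : CoherentMap K) (ψ : Antidual Q)
    (z : Z) : 𝒬.quantizeExt A ψ (𝒬.ket z) = ψ (𝒬.ket (A.adj z)) :=
  congrArg ψ (𝒬.quantize_ket (A.adjoint 𝒬) z)

/-- If the difference quotients converge on coherent states, then they converge on the whole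
quantum space, and the limit is an antilinear functional. -/
theorem QuantumSpace.exists_mem_graph_generator (𝒬 : QuantumSpace K Q) (A : ℝ → CoherentMap K)
    (ψ : Antidual Q) (G : Z → ℂ)
    (h : ∀ z, Tendsto (fun ε : ℝ => (ψ (𝒬.ket ((A ε).adj z)) - ψ (𝒬.ket z)) / (ε : ℂ)) (𝓝[≠] 0)
      (𝓝 (G z))) :
    ∃ χ : Antidual Q, (ψ, χ) ∈ (𝒬.generator A).graph ∧ ∀ z, χ (𝒬.ket z) = G z := by
  let q (φ : Q) (ε : ℝ) : ℂ := ((𝒬.quantizeExt (A ε) ψ - ψ) φ) / (ε : ℂ)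
  have hadd {x y : Q} {a b : ℂ} (hx : Tendsto (q x) (𝓝[≠] 0) (𝓝 a))
      (hy : Tendsto (q y) (𝓝[≠] 0) (𝓝 b)) : Tendsto (q (x + y)) (𝓝[≠] 0) (𝓝 (a + b)) := by
    refine (hx.add hy).congr fun ε => ?_
    simp only [q, map_add, add_div]
  have hsmul (c : ℂ) {x : Q} {a : ℂ} (hx : Tendsto (q x) (𝓝[≠] 0) (𝓝 a)) :
      Tendsto (q (c • x)) (𝓝[≠] 0) (𝓝 (conj c * a)) := by
    refine (hx.const_mul (conj c)).congr fun ε => ?_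
    simp only [q, map_smulₛₗ, smul_eq_mul, mul_div_assoc]
  have hket (z : Z) : Tendsto (q (𝒬.ket z)) (𝓝[≠] 0) (𝓝 (G z)) := by
    simpa only [q, LinearMap.sub_apply, 𝒬.quantizeExt_ket] using h z
  have hex (φ : Q) : ∃ l, Tendsto (q φ) (𝓝[≠] 0) (𝓝 l) := by
    refine 𝒬.ket_induction (P := fun φ => ∃ l, Tendsto (q φ) (𝓝[≠] 0) (𝓝 l))
      (fun z => ⟨_, hket z⟩) ⟨0, ?_⟩ ?_ ?_ φ
    · simp only [q, map_zero, zero_div]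
      exact tendsto_const_nhds
    · rintro x y ⟨a, ha⟩ ⟨b, hb⟩
      exact ⟨_, hadd ha hb⟩
    · rintro c x ⟨a, ha⟩
      exact ⟨_, hsmul c ha⟩
  choose l hl using hex
  -- Antilinearity of the limit comes from uniqueness of limits, since the difference quotients are
  -- antilinear in `φ`.
  let χ : Antidual Q :=
    { toFun := l
      map_add' := fun x y => tendsto_nhds_unique (hl _) (hadd (hl x) (hl y))
      map_smul' := fun c x => tendsto_nhds_unique (hl _) (hsmul c (hl x)) }
  refine ⟨χ, ?_, fun z => tendsto_nhds_unique (hl _) (hket z)⟩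
  rw [𝒬.generator_graph]
  exact hl

end Generator

/-! ### Graphs of sums, multiples and commutators -/

section Graph

variable {E : Type u} [AddCommGroup E] [Module ℂ E]

theorem add_mem_graph_add {S T : E →ₗ.[ℂ] E} {x y z : E} (hS : (x, y) ∈ S.graph)
    (hT : (x, z) ∈ T.graph) : (x, y + z) ∈ (S + T).graph := by
  rw [LinearPMap.mem_graph_iff] at hS hT ⊢
  obtain ⟨a, rfl, rfl⟩ := hS
  obtain ⟨b, hb, rfl⟩ := hT
  have hb' : (b : E) = a := hb
  refine ⟨⟨a, a.2, hb' ▸ b.2⟩, rfl, ?_⟩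
  rw [LinearPMap.add_apply]
  congr 2
  exact Subtype.ext hb'.symm

theorem sub_mem_graph_sub {S T : E →ₗ.[ℂ] E} {x y z : E} (hS : (x, y) ∈ S.graph)
    (hT : (x, z) ∈ T.graph) : (x, y - z) ∈ (S - T).graph := by
  rw [LinearPMap.mem_graph_iff] at hS hT ⊢
  obtain ⟨a, rfl, rfl⟩ := hS
  obtain ⟨b, hb, rfl⟩ := hT
  have hb' : (b : E) = a := hb
  refine ⟨⟨a, a.2, hb' ▸ b.2⟩, rfl, ?_⟩
  rw [LinearPMap.sub_apply]
  congr 2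
  exact Subtype.ext hb'.symm

theorem smul_mem_graph_smul {S : E →ₗ.[ℂ] E} {x y : E} (hS : (x, y) ∈ S.graph) (c : ℂ) :
    (x, c • y) ∈ (c • S).graph := by
  rw [LinearPMap.mem_graph_iff] at hS ⊢
  obtain ⟨a, rfl, rfl⟩ := hS
  exact ⟨a, rfl, rfl⟩

/-- Working with graphs carries membership in the natural domain along with the value: naming the
intermediate vectors `s`, `t` is what certifies the domain. -/
theorem sub_mem_graph_pcomm {S T : E →ₗ.[ℂ] E} {x s t st ts : E} (hS : (x, s) ∈ S.graph)
    (hT : (x, t) ∈ T.graph) (hST : (t, st) ∈ S.graph) (hTS : (s, ts) ∈ T.graph) :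
    (x, st - ts) ∈ (pcomm S T).graph :=
  sub_mem_graph_sub ((mem_graph_pmul S T x st).2 ⟨t, hT, hST⟩)
    ((mem_graph_pmul T S x ts).2 ⟨s, hS, hTS⟩)

theorem exists_apply_eq_of_mem_graph {S : E →ₗ.[ℂ] E} {x y : E} (h : (x, y) ∈ S.graph) :
    ∃ hx : x ∈ S.domain, S ⟨x, hx⟩ = y := by
  rw [LinearPMap.mem_graph_iff] at h
  obtain ⟨a, rfl, rfl⟩ := h
  exact ⟨a.2, rfl⟩

end Graph

/-! ### Creation and annihilation operators on functions on the Klauder space -/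

section KlauderFunctions

variable {V : Type u} [NormedAddCommGroup V] [InnerProductSpace ℂ V]

/-- Conjugating the parameter cancels the antilinearity of the inner product in its first argument,
leaving an affine function of `s`. -/
theorem hasDerivAt_inner_conj_line (z q : V) (p : V) (s : ℂ) :
    HasDerivAt (fun s : ℂ => ⟪z + conj s • p, q⟫_ℂ) ⟪p, q⟫_ℂ s := by
  simp only [inner_add_left, inner_smul_left, Complex.conj_conj]
  simpa using ((hasDerivAt_id s).mul_const ⟪p, q⟫_ℂ).const_add ⟪z, q⟫_ℂ

theorem ConjLineHolomorphic.inner_mul {f : ℂ × V → ℂ} (hf : ConjLineHolomorphic f) (q : V) :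
    ConjLineHolomorphic fun z => ⟪z.2, q⟫_ℂ * f z := fun z p =>
  Differentiable.mul (fun s => (hasDerivAt_inner_conj_line z.2 q p.2 s).differentiableAt) (hf z p)

/-- The product rule; its first term is the source of the canonical commutator. -/
theorem conjLineDeriv_inner_mul {f : ℂ × V → ℂ} (hf : ConjLineHolomorphic f) (p q : V)
    (z : ℂ × V) : conjLineDeriv (0, p) (fun z => ⟪z.2, q⟫_ℂ * f z) z =
      ⟪p, q⟫_ℂ * f z + ⟪z.2, q⟫_ℂ * conjLineDeriv (0, p) f z := by
  have h := (hasDerivAt_inner_conj_line z.2 q p 0).mul (hf.hasDerivAt z (0, p))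
  refine conjLineDeriv_eq (h.congr_deriv ?_)
  simp

theorem hasDerivAt_klauderProduct_conj_line (w z p : ℂ × V) (s : ℂ) :
    HasDerivAt (fun s : ℂ => klauderProduct V (z + conj s • p) w)
      ((conj p.1 + ⟪p.2, w.2⟫_ℂ) * klauderProduct V (z + conj s • p) w) s := by
  have h1 : HasDerivAt (fun s : ℂ => conj (z.1 + conj s * p.1)) (conj p.1) s := by
    simp only [map_add, map_mul, Complex.conj_conj]
    simpa using ((hasDerivAt_id s).mul_const (conj p.1)).const_add (conj z.1)
  have h := ((h1.add_const w.1).add (hasDerivAt_inner_conj_line z.2 w.2 p.2 s)).cexp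
  rw [mul_comm]
  exact h

theorem conjLineDeriv_klauderProduct (w p : ℂ × V) :
    conjLineDeriv p (fun z => klauderProduct V z w) =
      (conj p.1 + ⟪p.2, w.2⟫_ℂ) • fun z => klauderProduct V z w := by
  funext z
  refine conjLineDeriv_eq ((hasDerivAt_klauderProduct_conj_line w z p 0).congr_deriv ?_)
  simp

theorem conjLineHolomorphicTwo_klauderProduct (w : ℂ × V) :
    ConjLineHolomorphicTwo fun z => klauderProduct V z w := by
  have h : ConjLineHolomorphic fun z => klauderProduct V z w := fun z p s =>
    (hasDerivAt_klauderProduct_conj_line w z p s).differentiableAt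
  refine ⟨h, fun p => ?_, fun p q => ?_⟩
  · rw [conjLineDeriv_klauderProduct]
    exact h.const_smul _
  · simp only [conjLineDeriv_klauderProduct, conjLineDeriv_const_smul h]
    exact smul_comm _ _ _

variable {Q : Type v} [NormedAddCommGroup Q] [InnerProductSpace ℂ Q]
  (𝒬 : QuantumSpace (klauderProduct V) Q)

/-- Both sides have the same inner product with every coherent state, because the second `z₀` enters
the exponent of the kernel additively. -/
theorem ket_add_fst (a : ℂ) (z : ℂ × V) :
    𝒬.ket (a + z.1, z.2) = Complex.exp a • 𝒬.ket z := by
  rw [← sub_eq_zero]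
  refine 𝒬.eq_zero_of_inner_ket fun w => ?_
  rw [inner_sub_right, inner_smul_right, 𝒬.inner_ket, 𝒬.inner_ket, sub_eq_zero, klauderProduct,
    klauderProduct, ← Complex.exp_add]
  congr 1
  ring

theorem exists_mem_graph_annihilation {ψ : Antidual Q}
    (hψ : ConjLineHolomorphic fun z => ψ (𝒬.ket z)) (p : V) :
    ∃ χ : Antidual Q, (ψ, χ) ∈ (annihilation 𝒬 p).graph ∧
      (fun z => χ (𝒬.ket z)) = conjLineDeriv (0, p) fun z => ψ (𝒬.ket z) := by
  obtain ⟨χ, h, h'⟩ := 𝒬.exists_mem_graph_generator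
    (fun ε : ℝ => oscillator ((ε : ℂ) * 0) ((ε : ℂ) • p) ((ε : ℂ) • (0 : V))) ψ
    (conjLineDeriv (0, p) fun z => ψ (𝒬.ket z)) fun z => by
      have h := (HasDerivAt.comp_ofReal (z := 0) (hψ.hasDerivAt z (0, p))).tendsto_slope
      refine h.congr fun ε => ?_
      -- For real `ε` the conjugation is invisible, so the antiholomorphic line restricts to the
      -- orbit of the adjoint translations.
      have e : z + conj (ε : ℂ) • ((0, p) : ℂ × V) = (z.1, (ε : ℂ) • p + z.2) := by
        ext <;> simp [add_comm]
      simp only [slope, vsub_eq_sub, e]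
      simp [oscillator, div_eq_inv_mul]
  exact ⟨χ, h, funext h'⟩

theorem exists_mem_graph_creation (ψ : Antidual Q) (q : V) :
    ∃ χ : Antidual Q, (ψ, χ) ∈ (creation 𝒬 q).graph ∧
      (fun z => χ (𝒬.ket z)) = fun z => ⟪z.2, q⟫_ℂ * ψ (𝒬.ket z) := by
  obtain ⟨χ, h, h'⟩ := 𝒬.exists_mem_graph_generator
    (fun ε : ℝ => oscillator ((ε : ℂ) * 0) ((ε : ℂ) • (0 : V)) ((ε : ℂ) • q)) ψ
    (fun z => ⟪z.2, q⟫_ℂ * ψ (𝒬.ket z)) fun z => by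
      have h0 : HasDerivAt (fun s : ℂ => Complex.exp (s * ⟪z.2, q⟫_ℂ) * ψ (𝒬.ket z))
          (⟪z.2, q⟫_ℂ * ψ (𝒬.ket z)) ((0 : ℝ) : ℂ) := by
        simpa using (((hasDerivAt_id (0 : ℂ)).mul_const ⟪z.2, q⟫_ℂ).cexp).mul_const (ψ (𝒬.ket z))
      refine h0.comp_ofReal.tendsto_slope.congr fun ε => ?_
      have e : ψ (𝒬.ket ((oscillator ((ε : ℂ) * 0) ((ε : ℂ) • (0 : V)) ((ε : ℂ) • q)).adj z)) =
          Complex.exp (ε * ⟪z.2, q⟫_ℂ) * ψ (𝒬.ket z) := by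
        -- Antilinearity of `ψ` conjugates the factor `exp (ε * ⟪q, z.2⟫)`, which turns the inner
        -- product around.
        have := congrArg ψ (ket_add_fst 𝒬 ((ε : ℂ) * ⟪q, z.2⟫_ℂ) z)
        simpa [oscillator, inner_smul_left, add_comm, ← Complex.exp_conj] using this
      rw [e]
      simp [slope, div_eq_inv_mul]
  exact ⟨χ, h, funext h'⟩

end KlauderFunctions

/-! ### Functions of the completed quantum space -/

section Completed

variable {V : Type u} [NormedAddCommGroup V] [InnerProductSpace ℂ V]
  {Q : Type v} [NormedAddCommGroup Q] [InnerProductSpace ℂ Q]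
  (𝒬 : QuantumSpace (klauderProduct V) Q)

theorem conjLineHolomorphicTwo_inner_ket (φ : Q) :
    ConjLineHolomorphicTwo fun z => ⟪𝒬.ket z, φ⟫_ℂ := by
  refine 𝒬.ket_induction (P := fun φ => ConjLineHolomorphicTwo fun z => ⟪𝒬.ket z, φ⟫_ℂ)
    (fun w => ?_) ?_ (fun x y hx hy => ?_) (fun c x hx => ?_) φ
  · simpa only [𝒬.inner_ket] using conjLineHolomorphicTwo_klauderProduct w
  · simp only [inner_zero_right]
    exact ConjLineHolomorphicTwo.zero
  · simp only [inner_add_right]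
    exact hx.add hy
  · simp only [inner_smul_right]
    exact hx.const_smul c

/-- The squared norm is `exp (2 Re z₀ + ‖z.2‖²)`, and the norm on `ℂ × V` is the maximum of the two
component norms. -/
theorem norm_ket_le {R : ℝ} {z : ℂ × V} (hz : ‖z‖ ≤ R) :
    ‖𝒬.ket z‖ ≤ Real.exp (R + R ^ 2 / 2) := by
  have h0 : 0 ≤ R := (norm_nonneg z).trans hz
  have h1 : ‖z.1‖ ≤ R := (norm_fst_le z).trans hz
  have h2 : ‖z.2‖ ≤ R := (norm_snd_le z).trans hz
  have h : ‖𝒬.ket z‖ ^ 2 = ‖⟪𝒬.ket z, 𝒬.ket z⟫_ℂ‖ := by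
    rw [inner_self_eq_norm_sq_to_K]
    simp
  refine le_of_sq_le_sq ?_ (Real.exp_nonneg _)
  rw [h, 𝒬.inner_ket, klauderProduct, Complex.norm_exp, ← Real.exp_nat_mul]
  refine Real.exp_le_exp.2 ((Complex.re_le_norm _).trans ?_)
  refine (norm_add₃_le).trans ?_
  have h3 : ‖⟪z.2, z.2⟫_ℂ‖ ≤ R * R := (norm_inner_le_norm _ _).trans (by gcongr)
  rw [RCLike.norm_conj]
  push_cast
  linarith

/-- Approximate by vectors of `Q`; by Cauchy–Schwarz and the bound on coherent states, norm
convergence becomes uniform convergence on balls. -/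
theorem conjLineHolomorphicTwo_of_mem {ψ : Antidual Q} (hψ : ψ ∈ completedQuantumSpace Q) :
    ConjLineHolomorphicTwo fun z => ψ (𝒬.ket z) := by
  obtain ⟨x, rfl⟩ := hψ
  obtain ⟨φ, hφ⟩ : ∃ φ : ℕ → Q,
      Tendsto (fun n => (φ n : UniformSpace.Completion Q)) atTop (𝓝 x) := by
    obtain ⟨u, hu, hux⟩ := mem_closure_iff_seq_limit.1
      (UniformSpace.Completion.denseRange_coe (α := Q) x)
    choose φ hφ using hu
    exact ⟨φ, by simpa only [hφ] using hux⟩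
  refine TendstoUniformlyOnBalls.conjLineHolomorphicTwo (f := fun n z => ⟪𝒬.ket z, φ n⟫_ℂ) ?_
    fun n => conjLineHolomorphicTwo_inner_ket 𝒬 (φ n)
  intro R
  rw [Metric.tendstoUniformlyOn_iff]
  intro ε hε
  filter_upwards [Metric.tendsto_nhds.1 hφ (ε / Real.exp (R + R ^ 2 / 2)) (by positivity)]
    with n hn z hz
  rw [mem_closedBall_zero_iff] at hz
  rw [dist_comm, dist_eq_norm] at hn ⊢
  rw [lt_div_iff₀' (Real.exp_pos _)] at hn
  refine lt_of_le_of_lt ?_ hn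
  change ‖⟪𝒬.ket z, φ n⟫_ℂ - ⟪(𝒬.ket z : UniformSpace.Completion Q), x⟫_ℂ‖ ≤ _
  rw [← UniformSpace.Completion.inner_coe, ← inner_sub_right, norm_sub_rev x]
  refine (norm_inner_le_norm _ _).trans ?_
  rw [UniformSpace.Completion.norm_coe]
  gcongr
  exact norm_ket_le 𝒬 hz

end Completed

/-! ### Commutation relations -/

section Commutators

variable {V : Type u} [NormedAddCommGroup V] [InnerProductSpace ℂ V]
  {Q : Type v} [NormedAddCommGroup Q] [InnerProductSpace ℂ Q]
  (𝒬 : QuantumSpace (klauderProduct V) Q)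

/-- Products of two creation and annihilation operators are defined on the completed quantum
space; `a`, `c` stand for annihilation and creation. -/
theorem exists_ladder_products {ψ : Antidual Q} (hψ : ψ ∈ completedQuantumSpace Q) :
    ∃ (a c : V → Antidual Q) (aa ac ca cc : V → V → Antidual Q),
      (∀ p, (ψ, a p) ∈ (annihilation 𝒬 p).graph) ∧ (∀ p, (ψ, c p) ∈ (creation 𝒬 p).graph) ∧
      (∀ p q, (a q, aa p q) ∈ (annihilation 𝒬 p).graph) ∧
      (∀ p q, (c q, ac p q) ∈ (annihilation 𝒬 p).graph) ∧
      (∀ p q, (a q, ca p q) ∈ (creation 𝒬 p).graph) ∧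
      (∀ p q, (c q, cc p q) ∈ (creation 𝒬 p).graph) ∧
      (∀ p q, aa p q = aa q p) ∧ (∀ p q, cc p q = cc q p) ∧
      (∀ p q, ac p q = ca q p + ⟪p, q⟫_ℂ • ψ) := by
  have h := conjLineHolomorphicTwo_of_mem 𝒬 hψ
  choose a ha ha' using exists_mem_graph_annihilation 𝒬 h.holomorphic
  choose c hc hc' using exists_mem_graph_creation 𝒬 ψ
  choose aa haa haa' using fun p q => exists_mem_graph_annihilation 𝒬 (ψ := a q)
    (by rw [ha']; exact h.deriv_holomorphic _) p
  choose ac hac hac' using fun p q => exists_mem_graph_annihilation 𝒬 (ψ := c q)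
    (by rw [hc']; exact h.holomorphic.inner_mul q) p
  choose ca hca hca' using fun p q => exists_mem_graph_creation 𝒬 (a q) p
  choose cc hcc hcc' using fun p q => exists_mem_graph_creation 𝒬 (c q) p
  refine ⟨a, c, aa, ac, ca, cc, ha, hc, haa, hac, hca, hcc, fun p q => ?_, fun p q => ?_,
    fun p q => ?_⟩ <;> refine 𝒬.antidual_ext fun z => ?_
  · have e := h.deriv_comm (0, p) (0, q)
    rw [← ha', ← ha', ← haa', ← haa'] at e
    exact congrFun e z
  · have e1 (p q : V) : cc p q (𝒬.ket z) = ⟪z.2, p⟫_ℂ * c q (𝒬.ket z) := congrFun (hcc' p q) z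
    have e2 (q : V) : c q (𝒬.ket z) = ⟪z.2, q⟫_ℂ * ψ (𝒬.ket z) := congrFun (hc' q) z
    rw [e1, e1, e2, e2]
    ring
  · have e1 : ac p q (𝒬.ket z) = _ := congrFun (hac' p q) z
    have e2 : ca q p (𝒬.ket z) = ⟪z.2, q⟫_ℂ * a p (𝒬.ket z) := congrFun (hca' q p) z
    have e3 : a p (𝒬.ket z) = _ := congrFun (ha' p) z
    rw [hc', conjLineDeriv_inner_mul h.holomorphic] at e1
    rw [LinearMap.add_apply, LinearMap.smul_apply, e1, e2, e3, smul_eq_mul]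
    ring

theorem mem_graph_segal {q : V} {x a c : Antidual Q} (ha : (x, a) ∈ (annihilation 𝒬 q).graph)
    (hc : (x, c) ∈ (creation 𝒬 q).graph) :
    (x, ((Real.sqrt 2 : ℂ)⁻¹) • (a + c)) ∈ (segal 𝒬 q).graph :=
  smul_mem_graph_smul (add_mem_graph_add ha hc) _

end Commutators

end CoherentFock

theorem mainTheorem8 {V : Type*} [NormedAddCommGroup V] [InnerProductSpace ℂ V]
    {Q : Type*} [NormedAddCommGroup Q] [InnerProductSpace ℂ Q]
    (𝒬 : CoherentFock.QuantumSpace (CoherentFock.klauderProduct V) Q)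
    (p q : V) (ψ : CoherentFock.Antidual Q) (hψ : ψ ∈ CoherentFock.completedQuantumSpace Q) :
    (∃ h : ψ ∈ (CoherentFock.pcomm (CoherentFock.annihilation 𝒬 p)
        (CoherentFock.creation 𝒬 q)).domain,
      CoherentFock.pcomm (CoherentFock.annihilation 𝒬 p) (CoherentFock.creation 𝒬 q) ⟨ψ, h⟩ =
        (inner ℂ p q : ℂ) • ψ) ∧
    (∃ h : ψ ∈ (CoherentFock.pcomm (CoherentFock.annihilation 𝒬 p)
        (CoherentFock.annihilation 𝒬 q)).domain,
      CoherentFock.pcomm (CoherentFock.annihilation 𝒬 p) (CoherentFock.annihilation 𝒬 q) ⟨ψ, h⟩ =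
        0) ∧
    (∃ h : ψ ∈ (CoherentFock.pcomm (CoherentFock.creation 𝒬 p)
        (CoherentFock.creation 𝒬 q)).domain,
      CoherentFock.pcomm (CoherentFock.creation 𝒬 p) (CoherentFock.creation 𝒬 q) ⟨ψ, h⟩ = 0) ∧
    (∃ h : ψ ∈ (CoherentFock.pcomm (CoherentFock.segal 𝒬 p) (CoherentFock.segal 𝒬 q)).domain,
      CoherentFock.pcomm (CoherentFock.segal 𝒬 p) (CoherentFock.segal 𝒬 q) ⟨ψ, h⟩ =
        (Complex.I * ((inner ℂ p q : ℂ).im : ℂ)) • ψ) := by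
  obtain ⟨a, c, aa, ac, ca, cc, ha, hc, haa, hac, hca, hcc, haa', hcc', hac'⟩ :=
    CoherentFock.exists_ladder_products 𝒬 hψ
  refine ⟨CoherentFock.exists_apply_eq_of_mem_graph ?_,
    CoherentFock.exists_apply_eq_of_mem_graph ?_, CoherentFock.exists_apply_eq_of_mem_graph ?_,
    CoherentFock.exists_apply_eq_of_mem_graph ?_⟩
  · convert! CoherentFock.sub_mem_graph_pcomm (ha p) (hc q) (hac p q) (hca q p) using 2
    rw [hac', add_sub_cancel_left]
  · convert! CoherentFock.sub_mem_graph_pcomm (ha p) (ha q) (haa p q) (haa q p) using 2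
    rw [haa', sub_self]
  · convert! CoherentFock.sub_mem_graph_pcomm (hc p) (hc q) (hcc p q) (hcc q p) using 2
    rw [hcc', sub_self]
  -- The vector `x` is `Φ_s(q) ψ`. Graphs are subspaces, so it lies in the domains of both ladder
  -- operators for `p`, and `Φ_s(p)` can be applied.
  · have hs (p q : V) := CoherentFock.mem_graph_segal 𝒬
      (x := (Real.sqrt 2 : ℂ)⁻¹ • (a q + c q)) (a := (Real.sqrt 2 : ℂ)⁻¹ • (aa p q + ac p q))
      (c := (Real.sqrt 2 : ℂ)⁻¹ • (ca p q + cc p q))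
      (Submodule.smul_mem _ _ (Submodule.add_mem _ (haa p q) (hac p q)))
      (Submodule.smul_mem _ _ (Submodule.add_mem _ (hca p q) (hcc p q)))
    convert! CoherentFock.sub_mem_graph_pcomm (CoherentFock.mem_graph_segal 𝒬 (ha p) (hc p))
      (CoherentFock.mem_graph_segal 𝒬 (ha q) (hc q)) (hs p q) (hs q p) using 2
    have h2 : (Real.sqrt 2 : ℂ)⁻¹ * (Real.sqrt 2 : ℂ)⁻¹ = 2⁻¹ := by
      rw [← mul_inv, ← Complex.ofReal_mul, Real.mul_self_sqrt zero_le_two, Complex.ofReal_ofNat]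
    have him : Complex.I * ((inner ℂ p q : ℂ).im : ℂ) =
        2⁻¹ * ((inner ℂ p q : ℂ) - (inner ℂ q p : ℂ)) := by
      rw [← inner_conj_symm q p, Complex.sub_conj, Complex.ofReal_mul, Complex.ofReal_ofNat]
      ring
    -- With every `ac` put in the order `ca`, all second-order terms cancel; half of `⟪p, q⟫ - ⟪q,
    -- p⟫` remains.
    rw [haa' q p, hcc' q p, hac' p q, hac' q p, him, ← h2]
    module
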